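/- Let $N\in\mathbb N$, let $\mathfrak X\subset\mathbb R^N$ be open, and write $q=(x,D,r)$ for $x\in\mathfrak X$ (portfolio nominals), $D\in\mathbb R^N$ (deflators) and $r\in\mathbb R^N$ (short rates). Let $\mathcal H=L^2(\mathfrak X\times\mathbb R^{2N},\mathbb C,d^{3N}q)$ and put $$T=\frac{x}{|x|^2}\cdot\frac1\imath\frac{\partial}{\partial D},\qquad W=\pm\left|\frac{\partial}{\partial x}\right|(x\cdot D)-x\cdot(rD),\qquad E=D\cdot\frac1\imath\frac{\partial}{\partial x},$$ where $(rD)_j=r_jD_j$ and $\left|\frac{\partial}{\partial x}\right|=\sqrt{-\Delta_x}$ with the Dirichlet boundary condition on $\partial\mathfrak X\times\mathbb R^{2N}$. The quantized Hamilton function is the formal operator $$\frac12\left[\left(\frac{x}{|x|^2}\cdot\frac1\imath\frac{\partial}{\partial D}\right)\left(\pm\left|\frac{\partial}{\partial x}\right|(x\cdot D)-x\cdot(rD)\right)+\left(\pm(x\cdot D)\left|\frac{\partial}{\partial x}\right|-x\cdot(rD)\right)\left(\frac{x}{|x|^2}\cdot\frac1\imath\frac{\partial}{\partial D}\right)\right],$$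 understood weakly: for $\chi,\eta\in C_c^\infty((\mathfrak X\setminus\{0\})\times\mathbb R^{2N})$ its matrix element is $\frac12\left(\langle T\chi,W\eta\rangle+\langle W\chi,T\eta\rangle\right)$. Let $H$ be a self-adjoint Hamilton operator, i.e. a self-adjoint operator on $\mathcal H$ whose domain contains every $\eta\in C_c^\infty((\mathfrak X\setminus\{0\})\times\mathbb R^{2N})$ that this formula maps into $\mathcal H$, and which acts on such $\eta$ by the formula. Then there is exactly one strongly continuous one-parameter group of unitary operators $\{e^{\imath Ht}\}_{t\in\mathbb R}$ on $\mathcal H$ whose infinitesimal generator is $\imath H$ (domains included). Let $\psi_0\in\mathcal H$ satisfy the self-financing constraint $E\psi_0=0$ in the sense of distributions on $\mathfrak X\times\mathbb R^{2N}$ and $\int_{\mathfrak X\times\mathbb R^{2N}}|\psi_0(q)|^2\,d^{3N}q=1$. Then the Schrödinger initial value problem $$\imath\frac{d}{dt}\psi(t)=H\psi(t),\qquad \psi(0)=\psi_0$$ has the solution $$\psi(t)=e^{-\imath Ht}\psi_0,\qquad t\in\mathbb R .$$ More precisely: 1. $\psi$ is a weak solution: it is continuous and $\imath\frac{d}{dt}\langle\chi,\psi(t)\rangle=\langle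 H\chi,\psi(t)\rangle$ for every $\chi\in\mathrm{dom}(H)$. 2. If $\psi_0\in\mathrm{dom}(H)$, then $\psi$ is a strong solution: $\psi(t)\in\mathrm{dom}(H)$ and $\imath\psi'(t)=H\psi(t)$ in the norm of $\mathcal H$ for every $t$. 3. $\psi$ is unique: on every interval $J\ni 0$ (in particular on $[0,\infty)$) every weak or strong solution with initial value $\psi_0$ equals $e^{-\imath Ht}\psi_0$. 4. The resulting dynamics of portfolio nominals, deflators and short rates is a probability law at each time: for every $t$ the formula $P[q_t\in\mathcal Q]=\int_{\mathcal Q}|\psi(q,t)|^2\,d^{3N}q$ (integral over $\mathcal Q\cap(\mathfrak X\times\mathbb R^{2N})$) defines a probability measure. -/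

import Mathlib

open MeasureTheory
open scoped InnerProductSpace ContDiff

namespace MarketQM

noncomputable section

/-! ### Coordinates and the Hilbert space -/

/-- The coordinates `q = (x, D, r)`: portfolio nominals `x`, deflators `D` and short rates `r` of
`N` assets. The volume on this type is the Lebesgue measure `d^{3N} q`. -/
abbrev Config (N : ℕ) : Type :=
  EuclideanSpace ℝ (Fin N) × (EuclideanSpace ℝ (Fin N) × EuclideanSpace ℝ (Fin N))

variable {N : ℕ}

/-- The set `X × ℝ^{2N}` of configurations with nominals in `X`. -/
def region (X : Set (EuclideanSpace ℝ (Fin N))) : Set (Config N) := {q | q.1 ∈ X}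

/-- The Hilbert space `L²(X × ℝ^{2N}, ℂ, d^{3N} q)`. -/
abbrev StateSpace (X : Set (EuclideanSpace ℝ (Fin N))) : Type :=
  Lp ℂ 2 ((volume : Measure (Config N)).restrict (region X))

/-- Smooth functions with compact support contained in `X × ℝ^{2N}`. -/
structure IsTest (X : Set (EuclideanSpace ℝ (Fin N))) (f : Config N → ℂ) : Prop where
  smooth : ContDiff ℝ ∞ f
  compact : HasCompactSupport f
  support : tsupport f ⊆ region X

open Classical in
/-- The class in `L²(X × ℝ^{2N})` of a square integrable function (zero otherwise). It is only
applied to test functions, which are square integrable by `IsTest.memLp`. -/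
def toState (X : Set (EuclideanSpace ℝ (Fin N))) (f : Config N → ℂ) : StateSpace X :=
  if h : MemLp f 2 ((volume : Measure (Config N)).restrict (region X)) then h.toLp f else 0

theorem IsTest.memLp {X : Set (EuclideanSpace ℝ (Fin N))} {f : Config N → ℂ} (hf : IsTest X f) :
    MemLp f 2 ((volume : Measure (Config N)).restrict (region X)) :=
  (hf.smooth.continuous.memLp_of_hasCompactSupport hf.compact).restrict _

/-! ### Differential and multiplication operators on smooth functions -/

/-- `∂f/∂x_j`. -/
def dX (j : Fin N) (f : Config N → ℂ) (q : Config N) : ℂ :=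
  fderiv ℝ f q (EuclideanSpace.single j 1, 0, 0)

/-- `∂f/∂D_j`. -/
def dD (j : Fin N) (f : Config N → ℂ) (q : Config N) : ℂ :=
  fderiv ℝ f q (0, EuclideanSpace.single j 1, 0)

/-- `(x / |x|²) · (1/i) ∂/∂D`. -/
def opT (f : Config N → ℂ) (q : Config N) : ℂ :=
  ∑ j, ((q.1 j / ‖q.1‖ ^ 2 : ℝ) : ℂ) * (1 / Complex.I * dD j f q)

/-- Multiplication by `x · D`. -/
def opM (f : Config N → ℂ) (q : Config N) : ℂ :=
  ((∑ j, q.1 j * q.2.1 j : ℝ) : ℂ) * f q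

/-- Multiplication by `x · (rD)`, where `rD` is the componentwise product. -/
def opV (f : Config N → ℂ) (q : Config N) : ℂ :=
  ((∑ j, q.1 j * (q.2.2 j * q.2.1 j) : ℝ) : ℂ) * f q

/-- The quantized self-financing constraint `E = D · (1/i) ∂/∂x`. -/
def opE (f : Config N → ℂ) (q : Config N) : ℂ :=
  ∑ j, ((q.2.1 j : ℝ) : ℂ) * (1 / Complex.I * dX j f q)

/-- `E ψ = 0` in the sense of distributions on `X × ℝ^{2N}`. -/
def SatisfiesConstraint (X : Set (EuclideanSpace ℝ (Fin N))) (ψ : StateSpace X) : Prop :=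
  ∀ χ : Config N → ℂ, IsTest X χ → ⟪toState X (opE χ), ψ⟫_ℂ = 0

/-! ### The square root of a nonnegative self-adjoint operator given by its resolvent -/

section SquareRoot

variable {K : Type*} [NormedAddCommGroup K] [InnerProductSpace ℂ K] [CompleteSpace K]

/-- If `R = (1 + A)⁻¹` for a nonnegative self-adjoint operator `A`, then the functional calculus
of `R` gives `√A = √((1 - ρ)/ρ)(R)`, i.e. `√A` maps `√R v` to `√(1 - R) v` for `v` in `K`.
This is the graph of `√A`. -/
def sqrtGraph (R : K →L[ℂ] K) : Submodule ℂ (K × K) :=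
  LinearMap.range ((cfc Real.sqrt R).prod (cfc (fun ρ : ℝ => Real.sqrt (1 - ρ)) R)).toLinearMap

theorem norm_sqrt_resolvent {V : Type*} [NormedAddCommGroup V] [InnerProductSpace ℂ V]
    [CompleteSpace V] (ι : V →L[ℂ] K) (v : K) :
    ‖cfc Real.sqrt (ι ∘L ι.adjoint) v‖ = ‖ι.adjoint v‖ := by
  set R : K →L[ℂ] K := ι ∘L ι.adjoint with hR
  have hpos : R.IsPositive := ContinuousLinearMap.isPositive_one (𝕜 := ℂ) (E := V) |>.conj_adjoint ι
  have hnn : (0 : K →L[ℂ] K) ≤ R := by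
    rwa [ContinuousLinearMap.nonneg_iff_isPositive]
  have hsa : IsSelfAdjoint R := hpos.isSelfAdjoint
  have hS : IsSelfAdjoint (cfc Real.sqrt R) := IsSelfAdjoint.cfc
  have hSS : ∀ x, cfc Real.sqrt R (cfc Real.sqrt R x) = R x := by
    have : cfc Real.sqrt R * cfc Real.sqrt R = R := by
      rw [← cfc_mul _ _ R]
      conv_rhs => rw [← cfc_id ℝ R]
      apply cfc_congr
      intro x hx
      exact Real.mul_self_sqrt (spectrum_nonneg_of_nonneg hnn hx)
    intro x
    exact congrArg (fun T : K →L[ℂ] K => T x) this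
  have h1 : (‖cfc Real.sqrt R v‖ : ℝ) ^ 2 = ‖ι.adjoint v‖ ^ 2 := by
    have e1 : ⟪cfc Real.sqrt R v, cfc Real.sqrt R v⟫_ℂ = ⟪ι.adjoint v, ι.adjoint v⟫_ℂ := by
      have := ContinuousLinearMap.adjoint_inner_right (cfc Real.sqrt R) v (cfc Real.sqrt R v)
      rw [← this, hS.adjoint_eq, hSS, hR, ContinuousLinearMap.adjoint_inner_left]
      rfl
    rw [inner_self_eq_norm_sq_to_K, inner_self_eq_norm_sq_to_K] at e1
    exact_mod_cast e1
  exact (pow_left_inj₀ (norm_nonneg _) (norm_nonneg _) two_ne_zero).1 h1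

/-- The form domain is contained in the domain of the square root. -/
theorem range_le_sqrt_resolvent {V : Type*} [NormedAddCommGroup V] [InnerProductSpace ℂ V]
    [CompleteSpace V] (ι : V →L[ℂ] K) (w : V) :
    ∃ v, cfc Real.sqrt (ι ∘L ι.adjoint) v = ι w := by
  have hn : ∀ v, ‖cfc Real.sqrt (ι ∘L ι.adjoint) v‖ = ‖ι.adjoint v‖ := norm_sqrt_resolvent ι
  have hS : IsSelfAdjoint (cfc Real.sqrt (ι ∘L ι.adjoint)) := IsSelfAdjoint.cfc
  generalize cfc Real.sqrt (ι ∘L ι.adjoint) = S at hn hS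
  obtain ⟨σ, hσ⟩ := S.toLinearMap.rangeRestrict.exists_rightInverse_of_surjective
    S.toLinearMap.range_rangeRestrict
  have hσ' : ∀ y : LinearMap.range S.toLinearMap, S (σ y) = y := fun y =>
    congrArg Subtype.val (LinearMap.congr_fun hσ y)
  let f : StrongDual ℂ (LinearMap.range S.toLinearMap) :=
    LinearMap.mkContinuous ((innerSL ℂ w).toLinearMap ∘ₗ ι.adjoint.toLinearMap ∘ₗ σ) ‖w‖ (by
      intro y
      have h1 : ‖⟪w, ι.adjoint (σ y)⟫_ℂ‖ ≤ ‖w‖ * ‖ι.adjoint (σ y)‖ := norm_inner_le_norm _ _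
      rw [← hn, hσ'] at h1
      exact h1)
  obtain ⟨g, hg, -⟩ := exists_extension_norm_eq _ f
  refine ⟨(InnerProductSpace.toDual ℂ K).symm g, ext_inner_right ℂ fun x => ?_⟩
  have hx : ι.adjoint (σ ⟨S x, x, rfl⟩) = ι.adjoint x := by
    rw [← sub_eq_zero, ← map_sub, ← norm_eq_zero, ← hn, map_sub, hσ']
    simp
  have h2 := ContinuousLinearMap.adjoint_inner_left S x ((InnerProductSpace.toDual ℂ K).symm g)
  rw [hS.adjoint_eq] at h2
  rw [h2, InnerProductSpace.toDual_symm_apply,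
    show g (S x) = f ⟨S x, x, rfl⟩ from hg ⟨S x, x, rfl⟩]
  change ⟪w, ι.adjoint (σ ⟨S x, x, rfl⟩)⟫_ℂ = _
  rw [hx, ContinuousLinearMap.adjoint_inner_right]

/-- The graph of the square root is single-valued if the form domain is dense. -/
theorem sqrtGraph_single_valued {V : Type*} [NormedAddCommGroup V] [InnerProductSpace ℂ V]
    [CompleteSpace V] (ι : V →L[ℂ] K) (hι : DenseRange ι) (p : K × K)
    (hp : p ∈ sqrtGraph (ι ∘L ι.adjoint)) (h0 : p.1 = 0) : p.2 = 0 := by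
  obtain ⟨v, rfl⟩ := hp
  have h1 : cfc Real.sqrt (ι ∘L ι.adjoint) v = 0 := h0
  have h2 : ι.adjoint v = 0 := by
    rw [← norm_eq_zero, ← norm_sqrt_resolvent, h1, norm_zero]
  have h3 : v = 0 := by
    apply hι.eq_zero_of_inner_right ℂ
    intro w
    rw [← ContinuousLinearMap.adjoint_inner_right, h2, inner_zero_right]
  rw [h3]
  simp

end SquareRoot

/-! ### The operator `|∂/∂x| = √(-Δ_x)` with Dirichlet boundary condition on `∂X × ℝ^{2N}` -/

/-- The family `(f, ∂f/∂x_1, …, ∂f/∂x_N)` in `L²(X × ℝ^{2N})^{1+N}`. -/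
def jet (X : Set (EuclideanSpace ℝ (Fin N))) (f : Config N → ℂ) :
    PiLp 2 (fun _ : Option (Fin N) => StateSpace X) :=
  WithLp.toLp 2 fun o => match o with
    | none => toState X f
    | some j => toState X (dX j f)

/-- The Dirichlet form domain of `-Δ_x`: the closure of the test functions in the Sobolev norm
`(‖f‖² + ∑ j, ‖∂f/∂x_j‖²)^{1/2}`, each element being stored together with its weak `x`-gradient. -/
def dirichletSpace (X : Set (EuclideanSpace ℝ (Fin N))) :
    Submodule ℂ (PiLp 2 (fun _ : Option (Fin N) => StateSpace X)) :=
  (Submodule.span ℂ {v | ∃ f, IsTest X f ∧ v = jet X f}).topologicalClosure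

instance (X : Set (EuclideanSpace ℝ (Fin N))) : CompleteSpace (dirichletSpace X) :=
  (Submodule.isClosed_topologicalClosure _).completeSpace_coe

/-- The embedding `ι` of the Dirichlet form domain in `L²(X × ℝ^{2N})`. -/
def dirichletIncl (X : Set (EuclideanSpace ℝ (Fin N))) :
    dirichletSpace X →L[ℂ] StateSpace X :=
  (PiLp.proj 2 (fun _ : Option (Fin N) => StateSpace X) none) ∘L (dirichletSpace X).subtypeL

/-- The resolvent `R = (1 - Δ_x)⁻¹` of the Dirichlet Laplacian in the variable `x`: `u = R f` is
the weak solution of `u - Δ_x u = f`, i.e. `⟪∇_x v, ∇_x u⟫ + ⟪v, u⟫ = ⟪v, f⟫` for every `v` in the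
form domain, which says that `R = ι ι†`. -/
def dirichletResolvent (X : Set (EuclideanSpace ℝ (Fin N))) : StateSpace X →L[ℂ] StateSpace X :=
  dirichletIncl X ∘L (dirichletIncl X).adjoint

/-- The graph of `|∂/∂x| = √(-Δ_x)`. -/
def absGradGraph (X : Set (EuclideanSpace ℝ (Fin N))) :
    Submodule ℂ (StateSpace X × StateSpace X) :=
  sqrtGraph (dirichletResolvent X)

/-- The operator `|∂/∂x| = √(-Δ_x)` with Dirichlet boundary condition. -/
def absGrad (X : Set (EuclideanSpace ℝ (Fin N))) : StateSpace X →ₗ.[ℂ] StateSpace X :=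
  (absGradGraph X).toLinearPMap

/-- Test functions lie in the form domain. -/
theorem exists_dirichletIncl_eq {X : Set (EuclideanSpace ℝ (Fin N))} {f : Config N → ℂ}
    (hf : IsTest X f) : ∃ w : dirichletSpace X, dirichletIncl X w = toState X f :=
  ⟨⟨jet X f, Submodule.le_topologicalClosure _ (Submodule.subset_span ⟨f, hf, rfl⟩)⟩, rfl⟩

/-- Test functions lie in the domain of `|∂/∂x|`. -/
theorem IsTest.mem_absGrad_domain {X : Set (EuclideanSpace ℝ (Fin N))} {f : Config N → ℂ}
    (hf : IsTest X f) : toState X f ∈ (absGrad X).domain := by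
  obtain ⟨w, hw⟩ := exists_dirichletIncl_eq hf
  obtain ⟨v, hv⟩ := range_le_sqrt_resolvent (dirichletIncl X) w
  exact ⟨_, ⟨v, rfl⟩, hv.trans hw⟩

theorem denseRange_dirichletIncl {X : Set (EuclideanSpace ℝ (Fin N))} (hX : IsOpen X) :
    DenseRange (dirichletIncl X) := by
  have key : ∀ g : StateSpace X, (∀ w, ⟪dirichletIncl X w, g⟫_ℂ = 0) → g = 0 := by
    intro g hg
    have hΩ : IsOpen (region X : Set (Config N)) := hX.preimage continuous_fst
    have hloc : LocallyIntegrableOn (g : Config N → ℂ) (region X) volume := by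
      refine (locallyIntegrableOn_iff hΩ.isLocallyClosed).2 fun k hk hkc => ?_
      have h1 := ((Lp.memLp g).locallyIntegrable (by norm_num)).integrableOn_isCompact hkc
      rwa [IntegrableOn, Measure.restrict_restrict_of_subset hk] at h1
    have h0 := hΩ.ae_eq_zero_of_integral_contDiff_smul_eq_zero hloc (by
      intro φ h1 h2 h3
      have ht : IsTest X (fun q => (φ q : ℂ)) := by
        refine ⟨Complex.ofRealCLM.contDiff.comp h1, h2.comp_left Complex.ofReal_zero, ?_⟩
        exact (closure_mono fun q hq => by simpa using hq).trans h3
      obtain ⟨w, hw⟩ := exists_dirichletIncl_eq ht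
      have h4 := hg w
      rw [hw, L2.inner_def, toState, dif_pos ht.memLp] at h4
      rw [← setIntegral_eq_integral_of_forall_compl_eq_zero (s := region X)]
      · rw [← h4]
        refine integral_congr_ae ?_
        filter_upwards [ht.memLp.coeFn_toLp] with q hq
        rw [hq]
        simp [mul_comm]
      · intro q hq
        rw [image_eq_zero_of_notMem_tsupport (fun h => hq (h3 h)), zero_smul])
    refine (Lp.eq_zero_iff_ae_eq_zero).2 ?_
    exact (ae_restrict_iff' hΩ.measurableSet).2 h0
  have h2 : (LinearMap.range (dirichletIncl X).toLinearMap).topologicalClosure = ⊤ := by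
    rw [Submodule.topologicalClosure_eq_top_iff, Submodule.eq_bot_iff]
    intro g hg
    exact key g fun w => (Submodule.mem_orthogonal _ g).1 hg _ ⟨w, rfl⟩
  exact Submodule.dense_iff_topologicalClosure_eq_top.2 h2

/-- `absGrad X` has the intended graph. -/
theorem absGrad_graph {X : Set (EuclideanSpace ℝ (Fin N))} (hX : IsOpen X) :
    (absGrad X).graph = absGradGraph X :=
  Submodule.toLinearPMap_graph_eq _ fun p hp h0 =>
    sqrtGraph_single_valued (dirichletIncl X) (denseRange_dirichletIncl hX) p hp h0

open Classical in
/-- The value `|∂/∂x| f` for `f` in the domain of `|∂/∂x|`, extended by zero. It is only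
applied to test functions, which lie in the domain. -/
def absGradApply (X : Set (EuclideanSpace ℝ (Fin N))) (f : StateSpace X) : StateSpace X :=
  if h : f ∈ (absGrad X).domain then absGrad X ⟨f, h⟩ else 0

/-! ### The Hamilton operator -/

/-- `(± |∂/∂x| (x · D) - x · (rD)) f`, the sign being `ε`. -/
def opW (X : Set (EuclideanSpace ℝ (Fin N))) (ε : ℝ) (f : Config N → ℂ) : StateSpace X :=
  (ε : ℂ) • absGradApply X (toState X (opM f)) - toState X (opV f)

/-- The sesquilinear form `⟪χ, H η⟫` on test functions of the formal Hamilton operator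
`½ [T (ε |∂/∂x| (x·D) - x·(rD)) + (ε (x·D) |∂/∂x| - x·(rD)) T]`,
`T = (x / |x|²) · (1/i) ∂/∂D`. -/
def hamiltonForm (X : Set (EuclideanSpace ℝ (Fin N))) (ε : ℝ) (χ η : Config N → ℂ) : ℂ :=
  1 / 2 * (⟪toState X (opT χ), opW X ε η⟫_ℂ + ⟪opW X ε χ, toState X (opT η)⟫_ℂ)

/-- `g = H η` weakly, for the formal Hamilton operator `H`. The test functions vanish near
`x = 0`, where the coefficient `x / |x|²` is singular. -/
def IsHamiltonValue (X : Set (EuclideanSpace ℝ (Fin N))) (ε : ℝ) (η : Config N → ℂ)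
    (g : StateSpace X) : Prop :=
  ∀ χ : Config N → ℂ, IsTest (X \ {0}) χ → ⟪toState X χ, g⟫_ℂ = hamiltonForm X ε χ η

/-- `H` is a self-adjoint Hamilton operator on `L²(X × ℝ^{2N})`: a self-adjoint operator whose
domain contains every test function `η` (vanishing near `x = 0`) with `H η ∈ L²`, and which
acts on these by the formula for the quantized Hamilton function. -/
structure IsHamiltonOperator (X : Set (EuclideanSpace ℝ (Fin N))) (ε : ℝ)
    (H : StateSpace X →ₗ.[ℂ] StateSpace X) : Prop where
  selfAdjoint : IsSelfAdjoint H
  apply_test : ∀ (η : Config N → ℂ) (g : StateSpace X), IsTest (X \ {0}) η →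
    IsHamiltonValue X ε η g → ∃ h : toState X η ∈ H.domain, H ⟨toState X η, h⟩ = g

/-! ### Unitary groups and the Schrödinger equation -/

section Abstract

variable {K : Type*} [NormedAddCommGroup K] [InnerProductSpace ℂ K]

/-- Strongly continuous one-parameter groups of unitary operators. -/
structure IsUnitaryGroup (U : ℝ → (K ≃ₗᵢ[ℂ] K)) : Prop where
  map_zero : ∀ φ, U 0 φ = φ
  map_add : ∀ s t φ, U (s + t) φ = U s (U t φ)
  strongly_continuous : ∀ φ, Continuous fun t => U t φ

/-- `U t = e^{iHt}` is the group that Stone's theorem associates with `H`: a strongly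
continuous unitary group whose infinitesimal generator is `iH`, with the domain of `H` being
exactly the set of vectors at which the generator exists. -/
structure IsStoneGroup (H : K →ₗ.[ℂ] K) (U : ℝ → (K ≃ₗᵢ[ℂ] K)) : Prop where
  isUnitaryGroup : IsUnitaryGroup U
  generator : ∀ φ w : K, (∃ h : φ ∈ H.domain, H ⟨φ, h⟩ = w) ↔
    HasDerivAt (fun t : ℝ => U t φ) (Complex.I • w) 0

/-- `ψ` solves `i ψ' = H ψ`, `ψ(0) = ψ₀` on the time set `J` in the strong sense. -/
structure IsStrongSolution (H : K →ₗ.[ℂ] K) (ψ₀ : K) (J : Set ℝ) (ψ : ℝ → K) : Prop where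
  initial : ψ 0 = ψ₀
  schroedinger : ∀ t ∈ J, ∃ h : ψ t ∈ H.domain,
    HasDerivWithinAt (fun τ : ℝ => Complex.I • ψ τ) (H ⟨ψ t, h⟩) J t

/-- `ψ` solves `i ψ' = H ψ`, `ψ(0) = ψ₀` on the time set `J` in the weak sense: `ψ` is
continuous and `i d/dt ⟪χ, ψ(t)⟫ = ⟪H χ, ψ(t)⟫` for every `χ` in the domain of `H`. -/
structure IsWeakSolution (H : K →ₗ.[ℂ] K) (ψ₀ : K) (J : Set ℝ) (ψ : ℝ → K) : Prop where
  initial : ψ 0 = ψ₀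
  continuousOn : ContinuousOn ψ J
  schroedinger : ∀ χ : H.domain, ∀ t ∈ J,
    HasDerivWithinAt (fun τ : ℝ => Complex.I * ⟪(χ : K), ψ τ⟫_ℂ) ⟪H χ, ψ t⟫_ℂ J t

end Abstract

/-- The law of the coordinates `q = (x, D, r)` in the state `ψ`, with density `|ψ(q)|²`:
`P[q ∈ Q] = ∫_Q |ψ(q)|² d^{3N} q`. -/
def coordinateLaw (X : Set (EuclideanSpace ℝ (Fin N))) (ψ : StateSpace X) :
    Measure (Config N) :=
  ((volume : Measure (Config N)).restrict (region X)).withDensity fun q => ‖ψ q‖ₑ ^ 2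

end

end MarketQM

/-!
The theorem is Stone's theorem for the self-adjoint operator `H`, together with the conservation
of the norm.

A self-adjoint `H` is described by the bounded operator `B = (H + i)⁻¹`, which is normal with
`B - B† = -2i B B†` and has the domain of `H` as its range (`exists_resolvent`). The spectrum of `B`
may contain the value `0`, corresponding to `h = ±∞`, where `e^{ith}` has no limit, so the unitary
`e^{itH}` itself is out of reach of the continuous functional calculus of `B`;
`e^{itH} B = f_t(B)` with `f_t(z) = z exp(it Re(1/z))` is within reach, because of the factor `z`. From
`|f_t(z)| = |z|` one gets `‖f_t(B) v‖ = ‖B v‖`, so `B v ↦ f_t(B) v` extends from the dense range of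
`B` to an isometry (`phaseIsometry`), and `f_s f_t = z f_{s+t}` gives the group law. Strong
continuity follows from `|f_t(z) - z| ≤ |t|`. The same bound says that the difference quotients of
`f_t(B)` at `t = 0` are bounded, so their strong convergence need only be checked on the range of
`B†`, where it is norm convergence by a second order estimate of `f_t(z) z̄`
(`tendsto_inv_smul_phaseOp_sub`). Hence `iH` is contained in the generator, and
conversely a vector at which the generator exists lies in the domain of `H† = H`
(`isStoneGroup_of_isSelfAdjoint`).

Weak solutions are unique because, for `χ` in the domain of `H`, the function
`⟪e^{-iHt} χ, ψ(t)⟫` has derivative zero on the interval (`IsWeakSolution.eq_of_isStoneGroup`).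
Strong solutions are weak solutions since `H` is symmetric, and uniqueness of the group is a case
of uniqueness of the solutions. The law of the coordinates has total mass `‖ψ(t)‖² = ‖ψ₀‖² = 1`.
-/

namespace MarketQM

noncomputable section

/-! ### The resolvent of a self-adjoint operator -/

section Resolvent

variable {K : Type*} [NormedAddCommGroup K] [InnerProductSpace ℂ K]
  {H : K →ₗ.[ℂ] K}

/-- `H + c` as a linear map on the domain of `H`. -/
def addConst (H : K →ₗ.[ℂ] K) (c : ℂ) : H.domain →ₗ[ℂ] K :=
  H.toFun + c • H.domain.subtype

theorem addConst_apply (c : ℂ) (x : H.domain) : addConst H c x = H x + c • (x : K) := rfl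

variable [CompleteSpace K]

theorem inner_apply_left_of_isSelfAdjoint (hH : IsSelfAdjoint H) (x y : H.domain) :
    ⟪H x, (y : K)⟫_ℂ = ⟪(x : K), H y⟫_ℂ := by
  have h := LinearPMap.adjoint_isFormalAdjoint hH.dense_domain
  rw [LinearPMap.isSelfAdjoint_def.1 hH] at h
  exact h x y

/-- The adjoint relation on all of `H.domain` already puts a vector into the domain. -/
theorem exists_apply_eq_of_isSelfAdjoint (hH : IsSelfAdjoint H) (y w : K)
    (h : ∀ x : H.domain, ⟪H x, y⟫_ℂ = ⟪(x : K), w⟫_ℂ) :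
    ∃ hy : y ∈ H.domain, H ⟨y, hy⟩ = w := by
  have h' : ∀ x : H.domain, ⟪w, (x : K)⟫_ℂ = ⟪y, H x⟫_ℂ := fun x => by
    rw [← inner_conj_symm, ← h, inner_conj_symm]
  have hd := LinearPMap.mem_adjoint_domain_of_exists (T := H) y ⟨w, h'⟩
  have : ∃ hy : y ∈ H.adjoint.domain, H.adjoint ⟨y, hy⟩ = w :=
    ⟨hd, LinearPMap.adjoint_apply_eq hH.dense_domain ⟨y, hd⟩ h'⟩
  rwa [LinearPMap.isSelfAdjoint_def.1 hH] at this

theorem norm_addConst_sq (hH : IsSelfAdjoint H) {c : ℂ} (hc : star c = -c) (x : H.domain) :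
    ‖addConst H c x‖ ^ 2 = ‖H x‖ ^ 2 + ‖c‖ ^ 2 * ‖(x : K)‖ ^ 2 := by
  have hc' : (starRingEnd ℂ) c = -c := hc
  have h : ⟪addConst H c x, addConst H c x⟫_ℂ =
      ⟪H x, H x⟫_ℂ + ⟪c • (x : K), c • (x : K)⟫_ℂ := by
    rw [addConst_apply, inner_add_left, inner_add_right, inner_add_right, inner_smul_left,
      inner_smul_right, inner_smul_left, inner_smul_right, inner_apply_left_of_isSelfAdjoint hH,
      hc']
    ring
  simp only [inner_self_eq_norm_sq_to_K, norm_smul] at h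
  rw [← mul_pow]
  exact_mod_cast h

theorem norm_le_norm_addConst (hH : IsSelfAdjoint H) {c : ℂ} (hc : star c = -c) (hc1 : ‖c‖ = 1)
    (x : H.domain) : ‖(x : K)‖ ≤ ‖addConst H c x‖ ∧ ‖H x‖ ≤ ‖addConst H c x‖ := by
  have h := norm_addConst_sq hH hc x
  rw [hc1, one_pow, one_mul] at h
  constructor <;> refine (pow_le_pow_iff_left₀ (norm_nonneg _) (norm_nonneg _) two_ne_zero).1 ?_ <;>
    rw [h] <;> nlinarith [sq_nonneg ‖H x‖, sq_nonneg ‖(x : K)‖]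

theorem isClosed_range_addConst (hH : IsSelfAdjoint H) {c : ℂ} (hc : star c = -c)
    (hc1 : ‖c‖ = 1) : IsClosed (LinearMap.range (addConst H c) : Set K) := by
  -- The graph of `H` is complete, and `(x, H x) ↦ H x + c x` is bounded below on it.
  let L : H.graph →L[ℂ] K :=
    (ContinuousLinearMap.snd ℂ K K + c • ContinuousLinearMap.fst ℂ K K) ∘L H.graph.subtypeL
  have hgr : ∀ x : H.domain, L ⟨(x, H x), H.mem_graph x⟩ = addConst H c x := fun x => rfl
  have : CompleteSpace H.graph := hH.isClosed.completeSpace_coe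
  have hL : AntilipschitzWith 1 L := by
    refine L.antilipschitz_of_bound fun p => ?_
    obtain ⟨⟨a, b⟩, hp⟩ := p
    obtain ⟨x, rfl, rfl⟩ := (LinearPMap.mem_graph_iff _).1 hp
    obtain ⟨h1, h2⟩ := norm_le_norm_addConst hH hc hc1 x
    rw [NNReal.coe_one, one_mul]
    exact max_le h1 h2
  convert hL.isClosed_range L.uniformContinuous using 1
  ext y
  constructor
  · rintro ⟨x, rfl⟩
    exact ⟨_, hgr x⟩
  · rintro ⟨⟨⟨a, b⟩, hp⟩, rfl⟩
    obtain ⟨x, rfl, rfl⟩ := (LinearPMap.mem_graph_iff _).1 hp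
    exact ⟨x, (hgr x).symm⟩

theorem addConst_bijective (hH : IsSelfAdjoint H) {c : ℂ} (hc : star c = -c) (hc1 : ‖c‖ = 1) :
    Function.Bijective (addConst H c) := by
  have inj : ∀ {c : ℂ}, star c = -c → ‖c‖ = 1 → ∀ x, addConst H c x = 0 → (x : K) = 0 := by
    intro c hc hc1 x hx
    have := (norm_le_norm_addConst hH hc hc1 x).1
    rwa [hx, norm_zero, norm_le_zero_iff] at this
  constructor
  · refine (injective_iff_map_eq_zero _).2 fun x hx => ?_
    exact Subtype.ext (inj hc hc1 x hx)
  · -- A vector orthogonal to the range lies in the kernel of `H - c`, which is trivial.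
    have hc' : (starRingEnd ℂ) c = -c := hc
    rw [← LinearMap.range_eq_top]
    have : CompleteSpace (LinearMap.range (addConst H c)) :=
      (isClosed_range_addConst hH hc hc1).completeSpace_coe
    rw [← Submodule.orthogonal_eq_bot_iff, Submodule.eq_bot_iff]
    intro z hz
    have hz' : ∀ x : H.domain, ⟪H x, z⟫_ℂ = ⟪(x : K), c • z⟫_ℂ := fun x => by
      have h := (Submodule.mem_orthogonal _ z).1 hz _ ⟨x, rfl⟩
      rw [addConst_apply, inner_add_left, inner_smul_left, hc'] at h
      rw [inner_smul_right]
      linear_combination h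
    obtain ⟨hd, hHz⟩ := exists_apply_eq_of_isSelfAdjoint hH z (c • z) hz'
    refine inj (c := -c) (by simp [hc']) (by simpa) ⟨z, hd⟩ ?_
    rw [addConst_apply, hHz]
    simp

/-- The bounded operator `(H + c)⁻¹`, for `H` self-adjoint and `c = ±i`. -/
def shiftedInverse (hH : IsSelfAdjoint H) {c : ℂ} (hc : star c = -c) (hc1 : ‖c‖ = 1) :
    K →L[ℂ] K :=
  LinearMap.mkContinuous
    (H.domain.subtype ∘ₗ (LinearEquiv.ofBijective _ (addConst_bijective hH hc hc1)).symm) 1 (by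
      intro v
      obtain ⟨x, rfl⟩ := (LinearEquiv.ofBijective _ (addConst_bijective hH hc hc1)).surjective v
      simpa using (norm_le_norm_addConst hH hc hc1 x).1)

theorem shiftedInverse_addConst (hH : IsSelfAdjoint H) {c : ℂ} (hc : star c = -c)
    (hc1 : ‖c‖ = 1) (x : H.domain) : shiftedInverse hH hc hc1 (addConst H c x) = x :=
  congrArg Subtype.val
    ((LinearEquiv.ofBijective _ (addConst_bijective hH hc hc1)).symm_apply_apply x)

/-- A self-adjoint `H` is described by the bounded operator `B = (H + i)⁻¹`: it is normal with
`B - B† = -2i B B†`, and the graph of `H` consists of the pairs `(B v, v - i B v)`. -/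
theorem exists_resolvent (hH : IsSelfAdjoint H) :
    ∃ B : K →L[ℂ] K, IsStarNormal B ∧ B - star B = (-2 * Complex.I) • (B * star B) ∧
      ∀ φ w : K, (∃ h : φ ∈ H.domain, H ⟨φ, h⟩ = w) ↔
        ∃ v, φ = B v ∧ w = v - Complex.I • B v := by
  have c₁ : star Complex.I = -Complex.I := Complex.conj_I
  have c₂ : star (-Complex.I) = -(-Complex.I) := by rw [star_neg, c₁]
  have n₁ : ‖Complex.I‖ = 1 := Complex.norm_I
  have n₂ : ‖-Complex.I‖ = 1 := by rw [norm_neg, n₁]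
  set B := shiftedInverse hH c₁ n₁ with hB
  set B' := shiftedInverse hH c₂ n₂ with hB'
  have s₁ := (addConst_bijective hH c₁ n₁).2
  have s₂ := (addConst_bijective hH c₂ n₂).2
  have e₁ : ∀ x : H.domain, B (H x + Complex.I • (x : K)) = x :=
    shiftedInverse_addConst hH c₁ n₁
  have e₂ : ∀ x : H.domain, B' (H x + (-Complex.I) • (x : K)) = x :=
    shiftedInverse_addConst hH c₂ n₂
  have hstar : star B = B' := by
    rw [ContinuousLinearMap.star_eq_adjoint]
    refine ((ContinuousLinearMap.eq_adjoint_iff B' B).2 fun v w => ?_).symm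
    obtain ⟨x, rfl⟩ := s₂ v
    obtain ⟨y, rfl⟩ := s₁ w
    rw [addConst_apply, addConst_apply, e₁, e₂, inner_add_left, inner_add_right,
      inner_apply_left_of_isSelfAdjoint hH, inner_smul_left, inner_smul_right]
    simp
  have r₁ : ∀ v, B v - B' v = (-2 * Complex.I) • B (B' v) := by
    intro v
    obtain ⟨x, rfl⟩ := s₂ v
    have h : addConst H (-Complex.I) x =
        (H x + Complex.I • (x : K)) + (-2 * Complex.I) • (x : K) := by
      rw [addConst_apply]; module
    rw [addConst_apply, e₂, ← addConst_apply, h, map_add, e₁, map_smul]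
    module
  have r₂ : ∀ v, B v - B' v = (-2 * Complex.I) • B' (B v) := by
    intro v
    obtain ⟨x, rfl⟩ := s₁ v
    have h : addConst H Complex.I x =
        (H x + (-Complex.I) • (x : K)) - (-2 * Complex.I) • (x : K) := by
      rw [addConst_apply]; module
    rw [addConst_apply, e₁, ← addConst_apply, h, map_sub, e₂, map_smul]
    module
  refine ⟨B, ⟨?_⟩, ?_, fun φ w => ⟨?_, ?_⟩⟩
  · rw [hstar]
    ext v
    have h := (r₂ v).symm.trans (r₁ v)
    exact smul_right_injective K (by simp : (-2 * Complex.I) ≠ 0) h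
  · rw [hstar]
    ext v
    exact r₁ v
  · rintro ⟨h, rfl⟩
    exact ⟨_, (e₁ ⟨φ, h⟩).symm, by rw [e₁]; simp⟩
  · rintro ⟨v, rfl, rfl⟩
    obtain ⟨x, rfl⟩ := s₁ v
    rw [addConst_apply, e₁]
    exact ⟨x.2, by simp⟩

end Resolvent

/-! ### The regularized phase function -/

section PhaseFunction

open Filter Topology

/-- The function `z ↦ z exp(i t Re(1/z))`. If `z = (h + i)⁻¹` with `h` real, it is
`e^{i t h} (h + i)⁻¹`. The factor `z` makes it continuous at `0`, which corresponds to
`h = ±∞`; its value there is `0`. -/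
def phaseFun (t : ℝ) (z : ℂ) : ℂ := z * Complex.exp (Complex.I * ((t * (z⁻¹).re : ℝ) : ℂ))

theorem norm_phaseFun (t : ℝ) (z : ℂ) : ‖phaseFun t z‖ = ‖z‖ := by
  rw [phaseFun, norm_mul, Complex.norm_exp_I_mul_ofReal, mul_one]

theorem continuous_phaseFun (t : ℝ) : Continuous (phaseFun t) := by
  refine continuous_iff_continuousAt.2 fun z => ?_
  rcases eq_or_ne z 0 with rfl | hz
  · have h0 : phaseFun t 0 = 0 := by simp [phaseFun]
    rw [ContinuousAt, h0, tendsto_zero_iff_norm_tendsto_zero]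
    simp only [norm_phaseFun]
    exact continuous_norm.tendsto' 0 0 norm_zero
  · unfold phaseFun
    have h : Continuous fun w : ℂ => Complex.exp (Complex.I * ((t * w.re : ℝ) : ℂ)) :=
      Complex.continuous_exp.comp (continuous_const.mul
        (Complex.continuous_ofReal.comp (continuous_const.mul Complex.continuous_re)))
    exact continuousAt_id.mul (h.continuousAt.comp (continuousAt_inv₀ hz))

theorem phaseFun_zero (z : ℂ) : phaseFun 0 z = z := by simp [phaseFun]

theorem phaseFun_mul (s t : ℝ) (z : ℂ) : phaseFun s z * phaseFun t z = z * phaseFun (s + t) z := by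
  have h : Complex.exp (Complex.I * (((s + t) * (z⁻¹).re : ℝ) : ℂ)) =
      Complex.exp (Complex.I * ((s * (z⁻¹).re : ℝ) : ℂ)) *
        Complex.exp (Complex.I * ((t * (z⁻¹).re : ℝ) : ℂ)) := by
    rw [← Complex.exp_add]; push_cast; ring_nf
  rw [phaseFun, phaseFun, phaseFun, h]
  ring

theorem star_phaseFun_mul (t : ℝ) (z : ℂ) : star (phaseFun t z) * phaseFun t z = star z * z := by
  change (starRingEnd ℂ) _ * _ = (starRingEnd ℂ) _ * _
  rw [mul_comm, Complex.mul_conj', norm_phaseFun, mul_comm, Complex.mul_conj']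

theorem norm_mul_re_inv_le (z : ℂ) : ‖z‖ * |(z⁻¹).re| ≤ 1 := by
  rcases eq_or_ne z 0 with rfl | hz
  · simp
  · calc ‖z‖ * |(z⁻¹).re| ≤ ‖z‖ * ‖z⁻¹‖ := by gcongr; exact Complex.abs_re_le_norm _
      _ = 1 := by rw [← norm_mul, mul_inv_cancel₀ hz, norm_one]

theorem norm_phaseFun_sub_le (t : ℝ) (z : ℂ) : ‖phaseFun t z - z‖ ≤ |t| := by
  have h : phaseFun t z - z =
      z * (Complex.exp (Complex.I * ((t * (z⁻¹).re : ℝ) : ℂ)) - 1) := by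
    rw [phaseFun]; ring
  rw [h, norm_mul]
  calc _ ≤ ‖z‖ * ‖t * (z⁻¹).re‖ := by gcongr; exact Real.norm_exp_I_mul_ofReal_sub_one_le
    _ = |t| * (‖z‖ * |(z⁻¹).re|) := by rw [Real.norm_eq_abs, abs_mul]; ring
    _ ≤ |t| := mul_le_of_le_one_right (abs_nonneg _) (norm_mul_re_inv_le z)

theorem norm_exp_I_mul_sub_one_sub_le (x : ℝ) :
    ‖Complex.exp (Complex.I * x) - 1 - Complex.I * x‖ ≤ 2 * x ^ 2 := by
  have hn : ‖Complex.I * (x : ℂ)‖ = |x| := by simp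
  rcases le_total |x| 1 with hx | hx
  · refine (Complex.norm_exp_sub_one_sub_id_le (hn.trans_le hx)).trans ?_
    rw [hn, sq_abs]
    nlinarith [sq_nonneg x]
  · refine (norm_sub_le _ _).trans ?_
    have h1 : ‖Complex.exp (Complex.I * x) - 1‖ ≤ |x| := Real.norm_exp_I_mul_ofReal_sub_one_le
    rw [hn, ← sq_abs]
    nlinarith

/-- First order expansion of `phaseFun` at `t = 0`, after multiplication by `z̄`: the error
`|z|² (e^{ith} - 1 - ith)`, `h = Re(1/z)`, is bounded uniformly in `z`, since `|z| |h| ≤ 1`. -/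
theorem norm_phaseFun_sub_mul_star_le (t : ℝ) (z : ℂ) :
    ‖(phaseFun t z - z) * star z - t * (Complex.I / 2 * (z + star z))‖ ≤ 2 * t ^ 2 := by
  have hre : z * star z * (((z⁻¹).re : ℝ) : ℂ) = 1 / 2 * (z + star z) := by
    change z * (starRingEnd ℂ) z * _ = 1 / 2 * (z + (starRingEnd ℂ) z)
    rcases eq_or_ne z 0 with rfl | hz
    · simp
    · rw [Complex.mul_conj, Complex.add_conj, Complex.inv_re]
      have := Complex.normSq_pos.2 hz
      norm_cast
      field_simp
      push_cast
      rfl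
  have h : (phaseFun t z - z) * star z - t * (Complex.I / 2 * (z + star z)) =
      z * star z * (Complex.exp (Complex.I * ((t * (z⁻¹).re : ℝ) : ℂ)) - 1
        - Complex.I * ((t * (z⁻¹).re : ℝ) : ℂ)) := by
    rw [phaseFun]
    push_cast
    linear_combination (t * Complex.I) * hre
  rw [h, norm_mul, norm_mul, norm_star]
  calc _ ≤ ‖z‖ * ‖z‖ * (2 * (t * (z⁻¹).re) ^ 2) := by
        gcongr; exact norm_exp_I_mul_sub_one_sub_le _
    _ = 2 * t ^ 2 * (‖z‖ * |(z⁻¹).re|) ^ 2 := by rw [mul_pow ‖z‖, sq_abs]; ring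
    _ ≤ 2 * t ^ 2 :=
        mul_le_of_le_one_right (by positivity)
          (pow_le_one₀ (by positivity) (norm_mul_re_inv_le z))

end PhaseFunction

/-! ### Construction of the unitary group -/

section PhaseOperator

open Filter Topology

variable {K : Type*} [NormedAddCommGroup K] [InnerProductSpace ℂ K]

/-- A uniformly bounded family of operators that converges on a dense set converges everywhere. -/
theorem tendsto_apply_of_denseRange {ι α : Type*} {l : Filter ι} {A : ι → K →L[ℂ] K}
    {A₀ : K →L[ℂ] K} {C : NNReal} (hA : ∀ i, ‖A i‖ ≤ C) {e : α → K} (he : DenseRange e)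
    (h : ∀ a, Tendsto (fun i => A i (e a)) l (𝓝 (A₀ (e a)))) (v : K) :
    Tendsto (fun i => A i v) l (𝓝 (A₀ v)) := by
  have hE : UniformEquicontinuous fun i => (A i : K → K) :=
    LipschitzWith.uniformEquicontinuous _ C fun i => (A i).lipschitz.weaken (hA i)
  refine (hE.equicontinuous v).tendsto_of_mem_closure (s := Set.range e)
    (A₀.continuous.continuousWithinAt (s := Set.range e)) ?_ (he v)
  rintro _ ⟨a, rfl⟩
  exact h a

variable [CompleteSpace K]

/-- The operator `e^{iHt} (H + i)⁻¹`, given by the continuous functional calculus of the normal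
operator `B = (H + i)⁻¹`. -/
def phaseOp (B : K →L[ℂ] K) (t : ℝ) : K →L[ℂ] K := cfc (phaseFun t) B

variable (B : K →L[ℂ] K) [hB : IsStarNormal B]

theorem continuousOn_phaseFun (t : ℝ) (s : Set ℂ) : ContinuousOn (phaseFun t) s :=
  (continuous_phaseFun t).continuousOn

theorem phaseOp_zero : phaseOp B 0 = B := by
  have : phaseFun 0 = id := funext phaseFun_zero
  rw [phaseOp, this, cfc_id ℂ B]

theorem phaseOp_mul (s t : ℝ) : phaseOp B s * phaseOp B t = B * phaseOp B (s + t) := by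
  have h1 := cfc_mul (phaseFun s) (phaseFun t) B (continuousOn_phaseFun _ _)
    (continuousOn_phaseFun _ _)
  have h2 := cfc_mul (fun z => z) (phaseFun (s + t)) B continuousOn_id
    (continuousOn_phaseFun _ _)
  rw [cfc_id' ℂ B] at h2
  rw [phaseOp, phaseOp, phaseOp, ← h1, ← h2]
  exact cfc_congr fun z _ => phaseFun_mul s t z

theorem commute_phaseOp (t : ℝ) : phaseOp B t * B = B * phaseOp B t := by
  have h := cfc_commute_cfc (phaseFun t) (fun z => z) B
  rwa [cfc_id' ℂ B] at h

theorem norm_phaseOp_apply (t : ℝ) (v : K) : ‖phaseOp B t v‖ = ‖B v‖ := by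
  have h : star (phaseOp B t) * phaseOp B t = star B * B := by
    have h1 := cfc_mul (fun z => star (phaseFun t z)) (phaseFun t) B
      (continuousOn_phaseFun _ _).star (continuousOn_phaseFun _ _)
    have h2 := cfc_mul (fun z : ℂ => star z) (fun z => z) B continuousOn_id.star continuousOn_id
    rw [cfc_star] at h1 h2
    rw [cfc_id' ℂ B] at h2
    rw [phaseOp, ← h1, ← h2]
    exact cfc_congr fun z _ => star_phaseFun_mul t z
  have hs : ∀ A : K →L[ℂ] K, ⟪(star A * A) v, v⟫_ℂ = (‖A v‖ : ℂ) ^ 2 := fun A => by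
    exact (ContinuousLinearMap.adjoint_inner_left A v (A v)).trans
      (inner_self_eq_norm_sq_to_K (𝕜 := ℂ) (A v))
  have h3 := (hs (phaseOp B t)).symm.trans ((congrArg (fun A => ⟪A v, v⟫_ℂ) h).trans (hs B))
  refine (pow_left_inj₀ (norm_nonneg _) (norm_nonneg _) two_ne_zero).1 ?_
  exact_mod_cast h3

theorem norm_phaseOp_sub_le (t : ℝ) : ‖phaseOp B t - B‖ ≤ |t| := by
  have h := cfc_sub (phaseFun t) (fun z => z) B (continuousOn_phaseFun _ _) continuousOn_id
  rw [cfc_id' ℂ B] at h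
  rw [phaseOp, ← h]
  exact norm_cfc_le (abs_nonneg t) fun z _ => norm_phaseFun_sub_le t z

theorem norm_phaseOp_sub_mul_star_le (t : ℝ) :
    ‖(phaseOp B t - B) * star B - (t : ℂ) • ((Complex.I / 2) • (B + star B))‖ ≤ 2 * t ^ 2 := by
  have e : (phaseOp B t - B) * star B - (t : ℂ) • ((Complex.I / 2) • (B + star B)) =
      cfc (fun z => (phaseFun t z - z) * star z - t * (Complex.I / 2 * (z + star z))) B := by
    have c1 : ContinuousOn (phaseFun t) (spectrum ℂ B) := continuousOn_phaseFun _ _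
    have c2 : ContinuousOn (fun z : ℂ => star z) (spectrum ℂ B) := continuousOn_id.star
    rw [cfc_sub _ _ B (by fun_prop) (by fun_prop), cfc_mul _ _ B (by fun_prop) (by fun_prop),
      cfc_sub _ _ B (by fun_prop) (by fun_prop), cfc_const_mul _ _ B (by fun_prop),
      cfc_const_mul _ _ B (by fun_prop), cfc_add B _ _ (by fun_prop) (by fun_prop),
      cfc_star, cfc_id' ℂ B, phaseOp]
  rw [e]
  exact norm_cfc_le (by positivity) fun z _ => norm_phaseFun_sub_mul_star_le t z

variable {B} (hd : DenseRange B)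

include hd

theorem denseRange_star_of_isStarNormal : DenseRange ⇑(star B) := by
  have hc := hB.star_comm_self
  have h1 : (LinearMap.range (star B).toLinearMap).topologicalClosure = ⊤ := by
    rw [Submodule.topologicalClosure_eq_top_iff, Submodule.eq_bot_iff]
    intro v hv
    have h2 : B v = 0 := by
      refine ext_inner_left ℂ fun w => ?_
      rw [inner_zero_right, ← ContinuousLinearMap.adjoint_inner_left]
      exact (Submodule.mem_orthogonal _ v).1 hv _ ⟨w, rfl⟩
    have h3 : star B v = 0 := by
      have h4 : B (star B v) = 0 := by
        have := congrArg (fun A : K →L[ℂ] K => A v) hc.eq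
        change star B (B v) = B (star B v) at this
        rw [← this, h2, map_zero]
      have h5 : ⟪star B v, star B v⟫_ℂ = 0 := by
        have := ContinuousLinearMap.adjoint_inner_left B (star B v) v
        rw [h4, inner_zero_right] at this
        exact this
      exact inner_self_eq_zero.1 h5
    refine hd.eq_zero_of_inner_right ℂ fun w => ?_
    rw [← ContinuousLinearMap.adjoint_inner_right]
    change ⟪w, star B v⟫_ℂ = 0
    rw [h3, inner_zero_right]
  exact Submodule.dense_iff_topologicalClosure_eq_top.2 h1

theorem tendsto_inv_smul_phaseOp_sub (hres : B - star B = (-2 * Complex.I) • (B * star B))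
    (v : K) :
    Tendsto (fun t : ℝ => (t : ℂ)⁻¹ • (phaseOp B t v - B v)) (𝓝[≠] 0)
      (𝓝 (Complex.I • (v - Complex.I • B v))) := by
  have key : ∀ v, Tendsto (fun t : ℝ => ((t : ℂ)⁻¹ • (phaseOp B t - B)) v) (𝓝[≠] 0)
      (𝓝 ((Complex.I • (1 - Complex.I • B)) v)) := by
    refine tendsto_apply_of_denseRange (C := 1) (fun t => ?_)
      (denseRange_star_of_isStarNormal hd) fun v => ?_
    · rw [norm_smul, norm_inv, Complex.norm_real, NNReal.coe_one, Real.norm_eq_abs]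
      exact inv_mul_le_one_of_le₀ (norm_phaseOp_sub_le B t) (abs_nonneg t)
    · -- On `star B v` the limit is `i (1 - i B) (star B) = (i / 2) (B + star B)`.
      have e : (Complex.I • (1 - Complex.I • B)) (star B v) =
          ((Complex.I / 2) • (B + star B)) v := by
        have h := congrArg (fun A : K →L[ℂ] K => A v) hres
        have h' : B v - star B v = (-2 * Complex.I) • B (star B v) := h
        have h'' : B (star B v) = (Complex.I / 2) • (B v - star B v) := by
          rw [h', smul_smul]
          have : Complex.I / 2 * (-2 * Complex.I) = 1 := by
            linear_combination -Complex.I_mul_I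
          rw [this, one_smul]
        change Complex.I • (star B v - Complex.I • B (star B v)) =
          (Complex.I / 2) • (B v + star B v)
        rw [h'', smul_sub, smul_smul, smul_smul, Complex.I_mul_I]
        module
      rw [e, tendsto_iff_norm_sub_tendsto_zero]
      have hlim : Tendsto (fun t : ℝ => 2 * |t| * ‖v‖) (𝓝[≠] 0) (𝓝 0) := by
        refine Tendsto.mono_left ?_ nhdsWithin_le_nhds
        exact Continuous.tendsto' (by fun_prop) _ _ (by simp)
      refine squeeze_zero' (Eventually.of_forall fun _ => norm_nonneg _) ?_ hlim
      filter_upwards [self_mem_nhdsWithin] with t ht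
      have ht' : (t : ℂ) ≠ 0 := Complex.ofReal_ne_zero.2 ht
      have e2 : ((t : ℂ)⁻¹ • (phaseOp B t - B)) (star B v) - ((Complex.I / 2) • (B + star B)) v =
          (t : ℂ)⁻¹ • ((phaseOp B t - B) * star B
            - (t : ℂ) • ((Complex.I / 2) • (B + star B))) v := by
        change (t : ℂ)⁻¹ • (phaseOp B t - B) (star B v) - _ =
          (t : ℂ)⁻¹ • ((phaseOp B t - B) (star B v)
          - (t : ℂ) • ((Complex.I / 2) • (B + star B)) v)
        rw [smul_sub, inv_smul_smul₀ ht']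
      rw [e2, norm_smul, norm_inv, Complex.norm_real, Real.norm_eq_abs]
      calc _ ≤ |t|⁻¹ * (2 * t ^ 2 * ‖v‖) := by
            gcongr
            exact ContinuousLinearMap.le_of_opNorm_le _ (norm_phaseOp_sub_mul_star_le B t) v
        _ = 2 * |t| * ‖v‖ := by
            have := abs_pos.2 ht
            rw [← sq_abs]
            field_simp
  exact key v

/-- The isometry `e^{iHt}`, determined by `e^{iHt} B = phaseOp B t` on the dense range of `B`. -/
def phaseIsometry (t : ℝ) : K →ₗᵢ[ℂ] K where
  toLinearMap := ((phaseOp B t).toLinearMap.extendOfNorm B.toLinearMap).toLinearMap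
  norm_map' v := by
    have hn : ∃ C, ∀ x, ‖(phaseOp B t).toLinearMap x‖ ≤ C * ‖B.toLinearMap x‖ :=
      ⟨1, fun x => by rw [one_mul]; exact (norm_phaseOp_apply B t x).le⟩
    refine hd.induction_on v (isClosed_eq (by fun_prop) (by fun_prop)) fun x => ?_
    have := LinearMap.extendOfNorm_eq (f := (phaseOp B t).toLinearMap) (e := B.toLinearMap) hd hn x
    exact (congrArg norm this).trans (norm_phaseOp_apply B t x)

theorem phaseIsometry_apply (t : ℝ) (v : K) : phaseIsometry hd t (B v) = phaseOp B t v :=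
  LinearMap.extendOfNorm_eq (f := (phaseOp B t).toLinearMap) (e := B.toLinearMap) hd
    ⟨1, fun x => by rw [one_mul]; exact (norm_phaseOp_apply B t x).le⟩ v

theorem phaseIsometry_zero (φ : K) : phaseIsometry hd 0 φ = φ := by
  refine hd.induction_on φ (isClosed_eq (by fun_prop) (by fun_prop)) fun v => ?_
  rw [phaseIsometry_apply, phaseOp_zero]

theorem phaseIsometry_add (s t : ℝ) (φ : K) :
    phaseIsometry hd (s + t) φ = phaseIsometry hd s (phaseIsometry hd t φ) := by
  have h2 : DenseRange (B ∘ B) := hd.comp hd B.continuous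
  refine h2.induction_on φ (isClosed_eq (by fun_prop) (by fun_prop)) fun v => ?_
  have c : ∀ t, phaseOp B t (B v) = B (phaseOp B t v) := fun t =>
    congrArg (fun A : K →L[ℂ] K => A v) (commute_phaseOp B t)
  have m : phaseOp B s (phaseOp B t v) = B (phaseOp B (s + t) v) :=
    congrArg (fun A : K →L[ℂ] K => A v) (phaseOp_mul B s t)
  rw [Function.comp_apply, phaseIsometry_apply, phaseIsometry_apply, c, c, phaseIsometry_apply, m]

/-- The unitary operator `e^{iHt}`, with inverse `e^{-iHt}`. -/
def phaseUnitary (t : ℝ) : K ≃ₗᵢ[ℂ] K where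
  toLinearEquiv := LinearEquiv.ofLinearMap (phaseIsometry hd t).toLinearMap
    (phaseIsometry hd (-t)).toLinearMap
    (LinearMap.ext fun φ => by
      simp [← phaseIsometry_add, phaseIsometry_zero])
    (LinearMap.ext fun φ => by
      simp [← phaseIsometry_add, phaseIsometry_zero])
  norm_map' := (phaseIsometry hd t).norm_map

theorem phaseUnitary_apply (t : ℝ) (φ : K) : phaseUnitary hd t φ = phaseIsometry hd t φ := rfl

theorem isUnitaryGroup_phaseUnitary : IsUnitaryGroup (phaseUnitary hd) where
  map_zero := phaseIsometry_zero hd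
  map_add := phaseIsometry_add hd
  strongly_continuous φ := by
    have h0 : ∀ φ, Tendsto (fun t => phaseIsometry hd t φ) (𝓝 0) (𝓝 φ) := by
      refine tendsto_apply_of_denseRange (A₀ := ContinuousLinearMap.id ℂ K) (C := 1)
        (A := fun t => (phaseIsometry hd t).toContinuousLinearMap)
        (fun t => (phaseIsometry hd t).norm_toContinuousLinearMap_le) hd fun v => ?_
      change Tendsto (fun t => phaseIsometry hd t (B v)) (𝓝 0) (𝓝 (B v))
      simp only [phaseIsometry_apply]
      rw [tendsto_iff_norm_sub_tendsto_zero]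
      have hlim : Tendsto (fun t : ℝ => |t| * ‖v‖) (𝓝 0) (𝓝 0) :=
        Continuous.tendsto' (by fun_prop) _ _ (by simp)
      refine squeeze_zero (fun _ => norm_nonneg _) (fun t => ?_) hlim
      exact ContinuousLinearMap.le_of_opNorm_le _ (norm_phaseOp_sub_le B t) v
    refine continuous_iff_continuousAt.2 fun t => ?_
    have h1 : Tendsto (fun τ : ℝ => τ - t) (𝓝 t) (𝓝 0) :=
      Continuous.tendsto' (by fun_prop) _ _ (sub_self t)
    have h2 := (h0 (phaseIsometry hd t φ)).comp h1
    refine h2.congr fun τ => ?_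
    rw [Function.comp_apply, ← phaseIsometry_add, sub_add_cancel, phaseUnitary_apply]

theorem hasDerivAt_phaseUnitary (hres : B - star B = (-2 * Complex.I) • (B * star B)) (v : K) :
    HasDerivAt (fun t : ℝ => phaseUnitary hd t (B v)) (Complex.I • (v - Complex.I • B v)) 0 := by
  rw [hasDerivAt_iff_tendsto_slope]
  refine (tendsto_inv_smul_phaseOp_sub hd hres v).congr fun t => ?_
  rw [slope_def_module, phaseUnitary_apply, phaseUnitary_apply, phaseIsometry_apply,
    phaseIsometry_zero, sub_zero, ← Complex.ofReal_inv, Complex.coe_smul]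

end PhaseOperator

/-! ### Stone's theorem and the Schrödinger equation -/

section Stone

open Filter Topology

variable {K : Type*} [NormedAddCommGroup K] [InnerProductSpace ℂ K] {H : K →ₗ.[ℂ] K}
  {U : ℝ → (K ≃ₗᵢ[ℂ] K)}

theorem IsUnitaryGroup.apply_neg_apply (hU : IsUnitaryGroup U) (t : ℝ) (φ : K) :
    U t (U (-t) φ) = φ := by
  rw [← hU.map_add, add_neg_cancel, hU.map_zero]

theorem IsUnitaryGroup.inner_apply_left (hU : IsUnitaryGroup U) (t : ℝ) (φ χ : K) :
    ⟪U t φ, χ⟫_ℂ = ⟪φ, U (-t) χ⟫_ℂ := by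
  rw [← (U t).inner_map_map φ, hU.apply_neg_apply]

theorem IsUnitaryGroup.apply_comm (hU : IsUnitaryGroup U) (s t : ℝ) (φ : K) :
    U s (U t φ) = U t (U s φ) := by
  rw [← hU.map_add, add_comm, hU.map_add]

theorem hasDerivAt_map_apply (V : K ≃ₗᵢ[ℂ] K) {f : ℝ → K} {f' : K} {t : ℝ}
    (h : HasDerivAt f f' t) : HasDerivAt (fun τ => V (f τ)) (V f') t :=
  (((V : K →L[ℂ] K).restrictScalars ℝ).hasFDerivAt).comp_hasDerivAt t h

theorem hasDerivAt_comp_neg {f : ℝ → K} {f' : K} {t : ℝ} (h : HasDerivAt f f' (-t)) :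
    HasDerivAt (fun τ => f (-τ)) (-f') t := by
  simpa [Function.comp_def] using h.scomp t (hasDerivAt_neg t)

theorem IsUnitaryGroup.hasDerivAt (hU : IsUnitaryGroup U) {φ w : K}
    (h : HasDerivAt (fun t : ℝ => U t φ) w 0) (t : ℝ) :
    HasDerivAt (fun τ : ℝ => U τ φ) (U t w) t := by
  have h0 : HasDerivAt (fun τ : ℝ => U τ φ) w (t - t) := by rwa [sub_self]
  have h1 : HasDerivAt (fun τ : ℝ => U (τ - t) φ) w t := by
    simpa [Function.comp_def] using
      HasDerivAt.scomp (h := fun τ => τ - t) t h0 ((hasDerivAt_id t).sub_const t)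
  refine (hasDerivAt_map_apply (U t) h1).congr_of_eventuallyEq (Eventually.of_forall fun τ => ?_)
  change U τ φ = U t (U (τ - t) φ)
  rw [← hU.map_add, add_sub_cancel]

/-- It suffices to know the generator on the domain of `H`: it is symmetric, so a vector at which
it exists lies in the domain of `H† = H`. -/
theorem isStoneGroup_of_isSelfAdjoint [CompleteSpace K] (hH : IsSelfAdjoint H)
    (hU : IsUnitaryGroup U)
    (h : ∀ χ : H.domain, HasDerivAt (fun t : ℝ => U t χ) (Complex.I • H χ) 0) :
    IsStoneGroup H U where
  isUnitaryGroup := hU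
  generator φ w := by
    refine ⟨?_, fun hφ => exists_apply_eq_of_isSelfAdjoint hH φ w fun χ => ?_⟩
    · rintro ⟨hφ, rfl⟩
      exact h ⟨φ, hφ⟩
    · -- Compare the derivatives at `0` of `⟪U t χ, φ⟫ = ⟪χ, U (-t) φ⟫`.
      have h1 := (h χ).inner ℂ (hasDerivAt_const (0 : ℝ) φ)
      have h2 := hasDerivAt_comp_neg (t := 0) 
        (by rwa [neg_zero] : HasDerivAt (fun τ : ℝ => U τ φ) (Complex.I • w) (-0))
      have h3 := (hasDerivAt_const (0 : ℝ) (χ : K)).inner ℂ h2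
      simp only [← hU.inner_apply_left] at h3
      have h4 := h1.unique h3
      simp only [map_zero, inner_zero_right, inner_zero_left, zero_add, add_zero, inner_neg_right,
        inner_smul_left, inner_smul_right, Complex.conj_I, neg_mul, neg_inj] at h4
      exact mul_left_cancel₀ Complex.I_ne_zero h4

/-- Existence in Stone's theorem. -/
theorem exists_isStoneGroup [CompleteSpace K] (hH : IsSelfAdjoint H) :
    ∃ U : ℝ → (K ≃ₗᵢ[ℂ] K), IsStoneGroup H U := by
  obtain ⟨B, hn, hres, hgraph⟩ := exists_resolvent hH
  have hd : DenseRange B := by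
    refine hH.dense_domain.mono fun φ hφ => ?_
    obtain ⟨v, hv, -⟩ := (hgraph φ _).1 ⟨hφ, rfl⟩
    exact ⟨v, hv.symm⟩
  refine ⟨phaseUnitary hd, isStoneGroup_of_isSelfAdjoint hH (isUnitaryGroup_phaseUnitary hd) ?_⟩
  rintro ⟨φ, hφ⟩
  obtain ⟨v, rfl, hv⟩ := (hgraph φ _).1 ⟨hφ, rfl⟩
  rw [hv]
  exact hasDerivAt_phaseUnitary hd hres v

theorem IsStoneGroup.hasDerivAt (hU : IsStoneGroup H U) (χ : H.domain) (t : ℝ) :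
    HasDerivAt (fun τ : ℝ => U τ χ) (U t (Complex.I • H χ)) t :=
  hU.isUnitaryGroup.hasDerivAt ((hU.generator χ (H χ)).1 ⟨χ.2, rfl⟩) t

theorem IsStoneGroup.apply_mem_domain (hU : IsStoneGroup H U) (χ : H.domain) (t : ℝ) :
    ∃ h : U t χ ∈ H.domain, H ⟨U t χ, h⟩ = U t (H χ) := by
  refine (hU.generator _ _).2 ?_
  have h := hasDerivAt_map_apply (U t) ((hU.generator χ (H χ)).1 ⟨χ.2, rfl⟩)
  rw [map_smul] at h
  exact h.congr_of_eventuallyEq (Eventually.of_forall fun τ => hU.isUnitaryGroup.apply_comm τ t χ)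

theorem IsStoneGroup.isWeakSolution (hU : IsStoneGroup H U) (ψ₀ : K) :
    IsWeakSolution H ψ₀ Set.univ fun t => U (-t) ψ₀ where
  initial := by simp only [neg_zero, hU.isUnitaryGroup.map_zero]
  continuousOn := ((hU.isUnitaryGroup.strongly_continuous ψ₀).comp continuous_neg).continuousOn
  schroedinger χ t _ := by
    have h := ((hU.hasDerivAt χ t).inner ℂ (hasDerivAt_const t ψ₀)).const_mul Complex.I
    simp only [hU.isUnitaryGroup.inner_apply_left, map_zero, inner_zero_right,
      zero_add, inner_smul_left, Complex.conj_I] at h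
    refine HasDerivAt.hasDerivWithinAt (h.congr_deriv ?_)
    linear_combination -⟪H χ, U (-t) ψ₀⟫_ℂ * Complex.I_mul_I

theorem IsStoneGroup.isStrongSolution (hU : IsStoneGroup H U) {ψ₀ : K} (h₀ : ψ₀ ∈ H.domain) :
    IsStrongSolution H ψ₀ Set.univ fun t => U (-t) ψ₀ where
  initial := by simp only [neg_zero, hU.isUnitaryGroup.map_zero]
  schroedinger t _ := by
    obtain ⟨hd, hH⟩ := hU.apply_mem_domain ⟨ψ₀, h₀⟩ (-t)
    refine ⟨hd, HasDerivAt.hasDerivWithinAt ?_⟩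
    refine ((hasDerivAt_comp_neg (hU.hasDerivAt ⟨ψ₀, h₀⟩ (-t))).const_smul
      Complex.I).congr_deriv ?_
    rw [hH, map_smul, smul_neg, smul_smul, Complex.I_mul_I, neg_one_smul, neg_neg]

/-- Product rule for the pairing of a differentiable curve with a curve that is only continuous
and differentiable when tested against the fixed vector `f t`. -/
theorem hasDerivWithinAt_inner_of_weak {f ψ : ℝ → K} {f' : K} {d : ℂ} {J : Set ℝ} {t : ℝ}
    (hf : HasDerivWithinAt f f' J t) (hψ : ContinuousWithinAt ψ J t)
    (hd : HasDerivWithinAt (fun τ => ⟪f t, ψ τ⟫_ℂ) d J t) :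
    HasDerivWithinAt (fun τ => ⟪f τ, ψ τ⟫_ℂ) (⟪f', ψ t⟫_ℂ + d) J t := by
  have h1 : HasDerivWithinAt (fun τ => ⟪f τ - f t, ψ τ⟫_ℂ) ⟪f', ψ t⟫_ℂ J t := by
    rw [hasDerivWithinAt_iff_tendsto_slope] at hf ⊢
    have hψ' : Tendsto ψ (𝓝[J \ {t}] t) (𝓝 (ψ t)) :=
      hψ.mono_left (nhdsWithin_mono t Set.sdiff_subset)
    refine (hf.inner hψ').congr fun τ => ?_
    rw [slope_def_module, slope_def_module, sub_self, inner_zero_left, sub_zero,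
      ← Complex.coe_smul, ← Complex.coe_smul, inner_smul_left, Complex.conj_ofReal, smul_eq_mul]
  refine (h1.add hd).congr_of_eventuallyEq (Eventually.of_forall fun τ => ?_) ?_ <;>
    simp

/-- Tested against `χ` in the domain of `H`, the curve `U t (ψ t)` has derivative zero. -/
theorem IsWeakSolution.eq_of_isStoneGroup (hd : Dense (H.domain : Set K)) (hU : IsStoneGroup H U)
    {ψ₀ : K} {J : Set ℝ} {ψ : ℝ → K} (hJ : J.OrdConnected) (h0 : (0 : ℝ) ∈ J)
    (hψ : IsWeakSolution H ψ₀ J ψ) {t : ℝ} (ht : t ∈ J) : ψ t = U (-t) ψ₀ := by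
  have key : ∀ χ : H.domain, ⟪U (-t) χ, ψ t⟫_ℂ = ⟪(χ : K), ψ₀⟫_ℂ := by
    intro χ
    have hderiv : ∀ s ∈ J, HasDerivWithinAt (fun τ => ⟪U (-τ) χ, ψ τ⟫_ℂ) 0 J s := by
      intro s hs
      obtain ⟨hdom, hH⟩ := hU.apply_mem_domain χ (-s)
      have h1 := (hasDerivAt_comp_neg (hU.hasDerivAt χ (-s))).hasDerivWithinAt (s := J)
      have h2 := (hψ.schroedinger ⟨_, hdom⟩ s hs).const_mul (-Complex.I)
      have h3 : ∀ z : ℂ, -Complex.I * (Complex.I * z) = z := fun z => by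
        linear_combination -z * Complex.I_mul_I
      simp only [h3, hH] at h2
      refine (hasDerivWithinAt_inner_of_weak h1 (hψ.continuousOn s hs) h2).congr_deriv ?_
      rw [map_smul, inner_neg_left, inner_smul_left, Complex.conj_I]
      ring
    have h := Convex.norm_image_sub_le_of_norm_hasDerivWithin_le (C := 0) hderiv
      (fun _ _ => norm_zero.le) hJ.convex h0 ht
    rw [zero_mul, norm_le_zero_iff, sub_eq_zero] at h
    rw [h, neg_zero, hU.isUnitaryGroup.map_zero, hψ.initial]
  have h2 : U t (ψ t) = ψ₀ := by
    refine hd.eq_of_inner_right ℂ fun χ hχ => ?_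
    rw [← key ⟨χ, hχ⟩, hU.isUnitaryGroup.inner_apply_left, neg_neg]
  rw [← h2, ← hU.isUnitaryGroup.map_add, neg_add_cancel, hU.isUnitaryGroup.map_zero]

theorem IsStrongSolution.isWeakSolution [CompleteSpace K] (hH : IsSelfAdjoint H) {ψ₀ : K}
    {J : Set ℝ} {ψ : ℝ → K} (hψ : IsStrongSolution H ψ₀ J ψ) : IsWeakSolution H ψ₀ J ψ where
  initial := hψ.initial
  continuousOn t ht := by
    obtain ⟨_, h⟩ := hψ.schroedinger t ht
    refine (h.continuousWithinAt.const_smul (-Complex.I)).congr (fun τ _ => ?_) ?_ <;>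
      simp [smul_smul]
  schroedinger χ t ht := by
    obtain ⟨hd, h⟩ := hψ.schroedinger t ht
    have h1 := (hasDerivWithinAt_const t J (χ : K)).inner ℂ h
    simp only [inner_smul_right, inner_zero_left, mul_zero, add_zero] at h1
    exact h1.congr_deriv (inner_apply_left_of_isSelfAdjoint hH χ ⟨ψ t, hd⟩).symm

/-- Uniqueness in Stone's theorem. -/
theorem IsStoneGroup.unique (hd : Dense (H.domain : Set K)) {U' : ℝ → (K ≃ₗᵢ[ℂ] K)}
    (hU : IsStoneGroup H U) (hU' : IsStoneGroup H U') : U' = U := by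
  refine funext fun t => LinearIsometryEquiv.ext fun φ => ?_
  have := (hU'.isWeakSolution φ).eq_of_isStoneGroup hd hU Set.ordConnected_univ
    (Set.mem_univ _) (Set.mem_univ (-t))
  simpa only [neg_neg] using this

end Stone

/-! ### The law of the coordinates -/

theorem lintegral_enorm_sq_eq {α : Type*} [MeasurableSpace α] {μ : Measure α} (ψ : Lp ℂ 2 μ) :
    ∫⁻ q, ‖ψ q‖ₑ ^ 2 ∂μ = ‖ψ‖ₑ ^ 2 := by
  have h := eLpNorm_nnreal_pow_eq_lintegral (f := ψ) (μ := μ) (p := 2) two_ne_zero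
  rw [Lp.enorm_def]
  simpa using h.symm

/-- Total mass of the law of the coordinates. -/
theorem isProbabilityMeasure_coordinateLaw {N : ℕ} {X : Set (EuclideanSpace ℝ (Fin N))}
    {ψ : StateSpace X} (h : ‖ψ‖ = 1) : IsProbabilityMeasure (coordinateLaw X ψ) := by
  constructor
  rw [coordinateLaw, withDensity_apply _ MeasurableSet.univ, Measure.restrict_univ,
    lintegral_enorm_sq_eq, ← ofReal_norm, h, ENNReal.ofReal_one, one_pow]

theorem norm_eq_one_of_integral {N : ℕ} {X : Set (EuclideanSpace ℝ (Fin N))}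
    {ψ : StateSpace X} (h : ∫ q in region X, ‖ψ q‖ ^ 2 = 1) : ‖ψ‖ = 1 := by
  have h1 : (‖ψ‖ : ℝ) ^ 2 = 1 := by
    have hm : AEStronglyMeasurable (fun q => ‖ψ q‖ ^ 2) (volume.restrict (region X)) :=
      (Lp.aestronglyMeasurable ψ).norm.pow 2
    rw [← h, integral_eq_lintegral_of_nonneg_ae (Filter.Eventually.of_forall fun q => sq_nonneg _) hm]
    have e : ∀ q, ENNReal.ofReal (‖ψ q‖ ^ 2) = ‖ψ q‖ₑ ^ 2 := fun q => by
      rw [ENNReal.ofReal_pow (norm_nonneg _), ofReal_norm]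
    simp only [e]
    rw [lintegral_enorm_sq_eq, ENNReal.toReal_pow, toReal_enorm]
  exact (pow_eq_one_iff_of_nonneg (norm_nonneg _) two_ne_zero).1 h1

end

end MarketQM

theorem mainTheorem4 (N : ℕ) (X : Set (EuclideanSpace ℝ (Fin N))) (hX : IsOpen X)
    (ε : ℝ) (hε : ε = 1 ∨ ε = -1)
    (H : MarketQM.StateSpace X →ₗ.[ℂ] MarketQM.StateSpace X)
    (hH : MarketQM.IsHamiltonOperator X ε H) :
    ∃ U : ℝ → (MarketQM.StateSpace X ≃ₗᵢ[ℂ] MarketQM.StateSpace X),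
      MarketQM.IsStoneGroup H U ∧
      (∀ U' : ℝ → (MarketQM.StateSpace X ≃ₗᵢ[ℂ] MarketQM.StateSpace X),
        MarketQM.IsStoneGroup H U' → U' = U) ∧
      ∀ ψ₀ : MarketQM.StateSpace X, MarketQM.SatisfiesConstraint X ψ₀ →
        ∫ q in MarketQM.region X, ‖ψ₀ q‖ ^ 2 = 1 →
        MarketQM.IsWeakSolution H ψ₀ Set.univ (fun t => U (-t) ψ₀) ∧
        (ψ₀ ∈ H.domain → MarketQM.IsStrongSolution H ψ₀ Set.univ (fun t => U (-t) ψ₀)) ∧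
        (∀ (J : Set ℝ) (ψ : ℝ → MarketQM.StateSpace X), J.OrdConnected → (0 : ℝ) ∈ J →
          MarketQM.IsWeakSolution H ψ₀ J ψ ∨ MarketQM.IsStrongSolution H ψ₀ J ψ →
          ∀ t ∈ J, ψ t = U (-t) ψ₀) ∧
        ∀ t : ℝ, IsProbabilityMeasure (MarketQM.coordinateLaw X (U (-t) ψ₀)) := by
  have hsa := hH.selfAdjoint
  obtain ⟨U, hU⟩ := MarketQM.exists_isStoneGroup hsa
  refine ⟨U, hU, fun U' hU' => hU.unique hsa.dense_domain hU', fun ψ₀ _ hψ₀ =>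
    ⟨hU.isWeakSolution ψ₀, hU.isStrongSolution, fun J ψ hJ h0 hψ t ht => ?_, fun t => ?_⟩⟩
  · have hw : MarketQM.IsWeakSolution H ψ₀ J ψ := hψ.elim id fun h => h.isWeakSolution hsa
    exact hw.eq_of_isStoneGroup hsa.dense_domain hU hJ h0 ht
  · refine MarketQM.isProbabilityMeasure_coordinateLaw ?_
    rw [(U (-t)).norm_map]
    exact MarketQM.norm_eq_one_of_integral hψ₀
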